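/- A \emph{bar} is a closed horizontal line segment (of positive length) in the plane. For an integer $k\ge 0$, a finite simple graph $G$ is a \emph{bar $k$-visibility graph} if one can assign to its vertices pairwise disjoint bars such that two distinct vertices are adjacent in $G$ if and only if some vertical line segment joins a point of one of the two corresponding bars to a point of the other and intersects at most $k$ further bars of the assignment. Let $B_k$ be the family of bar $k$-visibility graphs, for $k\ge 0$. Theorem. For all integers $i,j\ge 0$ with $i\ne j$, one has $B_i\not\subseteq B_j$ and $B_j\not\subseteq B_i$. -/

import Mathlib

open Set

/-- A bar: a (nondegenerate) closed horizontal line segment in the plane. -/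
structure Bar where
  left : ℝ
  right : ℝ
  height : ℝ
  left_lt_right : left < right

/-- The points of the plane `ℝ × ℝ` that lie on a bar. -/
def Bar.carrier (b : Bar) : Set (ℝ × ℝ) := Icc b.left b.right ×ˢ {b.height}

/-- The vertical line segment with abscissa `x` between the ordinates `s` and `t`. -/
def verticalSegment (x s t : ℝ) : Set (ℝ × ℝ) := {x} ×ˢ uIcc s t

/-- A collection of pairwise nonintersecting bars in the plane, indexed by the vertex set `V`. -/
structure BarRepresentation (V : Type*) where
  bar : V → Bar
  disjoint : ∀ u v, u ≠ v → Disjoint (bar u).carrier (bar v).carrier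

namespace BarRepresentation

variable {V : Type*}

/-- The bars other than those of `u` and `v` that the vertical segment over `x` from the height of
the bar of `u` to the height of the bar of `v` intersects. -/
def obstructions (R : BarRepresentation V) (u v : V) (x : ℝ) : Set V :=
  {w | w ≠ u ∧ w ≠ v ∧
    ((R.bar w).carrier ∩ verticalSegment x (R.bar u).height (R.bar v).height).Nonempty}

/-- Some vertical line of sight connects a point of the bar of `u` to a point of the bar of `v`
and intersects at most `k` further bars. -/
def Sees (R : BarRepresentation V) (k : ℕ) (u v : V) : Prop :=
  ∃ x : ℝ, (x, (R.bar u).height) ∈ (R.bar u).carrier ∧ (x, (R.bar v).height) ∈ (R.bar v).carrier ∧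
    (R.obstructions u v x).encard ≤ k

theorem obstructions_comm (R : BarRepresentation V) (u v : V) (x : ℝ) :
    R.obstructions u v x = R.obstructions v u x := by
  ext w
  simp only [obstructions, verticalSegment, mem_ofPred_eq, uIcc_comm (R.bar u).height]
  tauto

theorem Sees.symm {R : BarRepresentation V} {k : ℕ} {u v : V} (h : R.Sees k u v) :
    R.Sees k v u := by
  obtain ⟨x, hu, hv, hx⟩ := h
  exact ⟨x, hv, hu, by rwa [obstructions_comm]⟩

/-- The `k`-visibility graph of a collection of bars. -/
def visibilityGraph (R : BarRepresentation V) (k : ℕ) : SimpleGraph V where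
  Adj u v := u ≠ v ∧ R.Sees k u v
  symm := ⟨fun _ _ h => ⟨h.1.symm, h.2.symm⟩⟩
  loopless := ⟨fun _ h => h.1 rfl⟩

end BarRepresentation

/-- A graph is a bar `k`-visibility graph if it has a bar `k`-visibility representation. -/
def IsBarVisibilityGraph {V : Type*} (k : ℕ) (G : SimpleGraph V) : Prop :=
  ∃ R : BarRepresentation V, R.visibilityGraph k = G

/-- The family `B_k` of (finite) bar `k`-visibility graphs; up to isomorphism, every finite graph
has a vertex set of the form `Fin n`. -/
def barVisibilityFamily (k : ℕ) : Set (Σ n : ℕ, SimpleGraph (Fin n)) :=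
  {G | IsBarVisibilityGraph k G.2}

/-! Take `i < j`. For a graph in `B_i` outside `B_j`: a bar `j`-visibility graph without a clique on
`j + 2` vertices has at most `j + 1` bars over each abscissa, so nothing is ever blocked and the
graph is an interval graph (`adj_iff_of_cliqueFree`). The graph of `spider i` has an `(i +
2)`-colouring, hence no such clique, but it contains a claw with subdivided edges in a position that
no interval graph allows.

For a graph in `B_j` outside `B_i`, edges are counted. A bar `k`-visibility graph on `n` vertices
has at most `3 * (k + 1) * n` edges (`card_edgeFinset_le`), and `staircase` falls short of this by
only a constant depending on `k`. For large `n`, the staircase for `j` has too many edges for `B_i`.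
-/

namespace BarRepresentation

/-- The bar of `u` has a point over `x`. -/
def Covers {V : Type*} (R : BarRepresentation V) (u : V) (x : ℝ) : Prop :=
  (R.bar u).left ≤ x ∧ x ≤ (R.bar u).right

theorem mem_carrier_iff {V : Type*} (R : BarRepresentation V) (u : V) (x y : ℝ) :
    (x, y) ∈ (R.bar u).carrier ↔ R.Covers u x ∧ y = (R.bar u).height := by
  simp [Bar.carrier, Covers]

theorem mem_obstructions_iff {V : Type*} (R : BarRepresentation V) (u v w : V) (x : ℝ) :
    w ∈ R.obstructions u v x ↔ w ≠ u ∧ w ≠ v ∧ R.Covers w x ∧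
      (R.bar w).height ∈ uIcc (R.bar u).height (R.bar v).height := by
  simp only [obstructions, mem_ofPred_eq]
  refine and_congr_right fun _ => and_congr_right fun _ => ⟨?_, ?_⟩
  · rintro ⟨⟨a, b⟩, h1, h2⟩
    rw [mem_carrier_iff] at h1
    simp only [verticalSegment, mem_prod, mem_singleton_iff] at h2
    obtain ⟨rfl, h2⟩ := h2
    exact ⟨h1.1, h1.2 ▸ h2⟩
  · rintro ⟨h1, h2⟩
    exact ⟨(x, (R.bar w).height), (mem_carrier_iff ..).2 ⟨h1, rfl⟩, by
      simpa [verticalSegment] using h2⟩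

theorem eq_of_height_eq {V : Type*} (R : BarRepresentation V) {u v : V} {x : ℝ}
    (hu : R.Covers u x) (hv : R.Covers v x) (h : (R.bar u).height = (R.bar v).height) :
    u = v := by
  by_contra huv
  exact Set.disjoint_left.1 (R.disjoint u v huv) ((R.mem_carrier_iff u x _).2 ⟨hu, rfl⟩)
    ((R.mem_carrier_iff v x _).2 ⟨hv, h⟩)

theorem sees_iff {V : Type*} (R : BarRepresentation V) (k : ℕ) (u v : V) :
    R.Sees k u v ↔ ∃ x, R.Covers u x ∧ R.Covers v x ∧ (R.obstructions u v x).encard ≤ k := by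
  simp [Sees, mem_carrier_iff]

theorem obstructions_eq_of_lt {V : Type*} (R : BarRepresentation V) {u v : V} {x : ℝ}
    (hu : R.Covers u x) (hv : R.Covers v x) (h : (R.bar u).height < (R.bar v).height) :
    R.obstructions u v x = {w | R.Covers w x ∧ (R.bar u).height < (R.bar w).height ∧
      (R.bar w).height < (R.bar v).height} := by
  ext w
  rw [mem_obstructions_iff, uIcc_of_le h.le, mem_ofPred_eq, mem_Icc]
  constructor
  · rintro ⟨h1, h2, h3, h4, h5⟩
    exact ⟨h3, h4.lt_of_ne fun h => h1 (R.eq_of_height_eq h3 hu h.symm),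
      h5.lt_of_ne fun h => h2 (R.eq_of_height_eq h3 hv h)⟩
  · rintro ⟨h1, h2, h3⟩
    exact ⟨by rintro rfl; exact h2.false, by rintro rfl; exact h3.false, h1, h2.le, h3.le⟩

end BarRepresentation

/-! ### Initial subsets and ranks in a finite set of heights -/

theorem Finset.exists_initial_subset_card_eq {α β : Type*} [DecidableEq α] [LinearOrder β]
    (f : α → β) (s : Finset α) :
    ∀ m ≤ s.card, ∃ t ⊆ s, t.card = m ∧ ∀ y ∈ t, ∀ z ∈ s, f z < f y → z ∈ t := by
  induction s using Finset.induction_on_max_value f with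
  | empty => intro m hm; exact ⟨∅, by simp, by simp_all, by simp⟩
  | insert a s ha hmax ih =>
    intro m hm
    rcases Nat.lt_or_ge s.card m with h | h
    · exact ⟨insert a s, Finset.Subset.refl _,
        le_antisymm (by rw [Finset.card_insert_of_notMem ha]; omega) hm, fun _ _ z hz _ => hz⟩
    · obtain ⟨t, hts, htc, ht⟩ := ih m h
      refine ⟨t, hts.trans (Finset.subset_insert _ _), htc, fun y hy z hz hzy => ?_⟩
      rcases Finset.mem_insert.1 hz with rfl | hz
      · exact absurd (hmax y (hts hy)) hzy.not_ge
      · exact ht y hy z hz hzy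

section Ranks

variable {α : Type*} {h : α → ℝ} {s : Finset α}

/-- Moving down strictly enlarges the set of elements up to the level `c`, so an element below `c`
is determined by how many lie between. This is what bounds the number of partners of a bar. -/
theorem eq_of_card_above_eq (hs : InjOn h s) {c : ℝ} {u v : α} (hu : u ∈ s) (hv : v ∈ s)
    (huc : h u < c) (hvc : h v < c)
    (he : (s.filter fun z => h u < h z ∧ h z < c).card =
      (s.filter fun z => h v < h z ∧ h z < c).card) : u = v := by
  have key : ∀ {a b : α}, b ∈ s → h b < c → h a < h b →
      (s.filter fun z => h b < h z ∧ h z < c).card <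
        (s.filter fun z => h a < h z ∧ h z < c).card := by
    intro a b hb hbc hab
    refine Finset.card_lt_card (Finset.ssubset_iff_subset_ne.2 ⟨?_, fun heq => ?_⟩)
    · exact Finset.monotone_filter_right _ fun z _ hz => ⟨hab.trans hz.1, hz.2⟩
    · have : b ∈ s.filter fun z => h b < h z ∧ h z < c := by
        rw [heq]; exact Finset.mem_filter.2 ⟨hb, hab, hbc⟩
      exact (Finset.mem_filter.1 this).2.1.false
  rcases lt_trichotomy (h u) (h v) with hlt | heq | hlt
  · exact absurd he (key hv hvc hlt).ne'
  · exact hs hu hv heq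
  · exact absurd he (key hu huc hlt).ne

theorem eq_of_card_below_eq (hs : InjOn h s) {c : ℝ} {u v : α} (hu : u ∈ s) (hv : v ∈ s)
    (huc : c < h u) (hvc : c < h v)
    (he : (s.filter fun z => c < h z ∧ h z < h u).card =
      (s.filter fun z => c < h z ∧ h z < h v).card) : u = v := by
  refine eq_of_card_above_eq (h := fun z => -h z) (c := -c)
    (fun a ha b hb hab => hs ha hb (neg_injective hab)) hu hv (neg_lt_neg huc) (neg_lt_neg hvc) ?_
  simpa only [neg_lt_neg_iff, and_comm] using he

end Ranks

/-! ### Absence of large cliques forces interval graphs -/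

namespace BarRepresentation

-- The lowest `k + 2` bars over a common abscissa form a clique: between two of them lie only
-- members of the same group, so at most `k` bars.
open Classical in
theorem cliqueFree_card_covers {V : Type*} [Fintype V] (R : BarRepresentation V) {k : ℕ}
    (hR : (R.visibilityGraph k).CliqueFree (k + 2)) (x : ℝ) :
    (Finset.univ.filter fun z => R.Covers z x).card ≤ k + 1 := by
  by_contra! hlt
  obtain ⟨t, hts, htc, ht⟩ := Finset.exists_initial_subset_card_eq
    (fun z => (R.bar z).height) _ (k + 2) hlt
  have hcov : ∀ z ∈ t, R.Covers z x := fun z hz => (Finset.mem_filter.1 (hts hz)).2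
  have key : ∀ u ∈ t, ∀ v ∈ t, (R.bar u).height < (R.bar v).height → R.Sees k u v := by
    intro u hu v hv huv
    refine (R.sees_iff k u v).2 ⟨x, hcov u hu, hcov v hv, ?_⟩
    rw [R.obstructions_eq_of_lt (hcov u hu) (hcov v hv) huv]
    have hsub : {w | R.Covers w x ∧ (R.bar u).height < (R.bar w).height ∧
        (R.bar w).height < (R.bar v).height} ⊆ (((t.erase u).erase v : Finset V) : Set V) := by
      rintro w ⟨h1, h2, h3⟩
      refine Finset.mem_erase.2 ⟨by rintro rfl; exact h3.false,
        Finset.mem_erase.2 ⟨by rintro rfl; exact h2.false, ?_⟩⟩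
      exact ht v hv w (by simpa using h1) h3
    refine (encard_le_encard hsub).trans ?_
    have hvu : v ∈ t.erase u := Finset.mem_erase.2 ⟨by rintro rfl; exact huv.false, hv⟩
    rw [encard_coe_eq_coe_finsetCard, Finset.card_erase_of_mem hvu,
      Finset.card_erase_of_mem hu, htc]
    simp
  refine hR t ⟨fun u hu v hv huv => ⟨huv, ?_⟩, htc⟩
  rcases lt_trichotomy (R.bar u).height (R.bar v).height with h | h | h
  · exact key u hu v hv h
  · exact absurd (R.eq_of_height_eq (hcov u hu) (hcov v hv) h) huv
  · exact (key v hv u hu h).symm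

/-- A bar `k`-visibility graph without a clique on `k + 2` vertices is an interval graph. -/
theorem adj_iff_of_cliqueFree {V : Type*} [Fintype V] (R : BarRepresentation V) {k : ℕ}
    (hR : (R.visibilityGraph k).CliqueFree (k + 2)) (u v : V) :
    (R.visibilityGraph k).Adj u v ↔ u ≠ v ∧
      (R.bar u).left ≤ (R.bar v).right ∧ (R.bar v).left ≤ (R.bar u).right := by
  classical
  constructor
  · rintro ⟨huv, hs⟩
    obtain ⟨x, hu, hv, -⟩ := (R.sees_iff k u v).1 hs
    exact ⟨huv, hu.1.trans hv.2, hv.1.trans hu.2⟩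
  · rintro ⟨huv, h1, h2⟩
    have hu : R.Covers u (max (R.bar u).left (R.bar v).left) :=
      ⟨le_max_left _ _, max_le (R.bar u).left_lt_right.le h2⟩
    have hv : R.Covers v (max (R.bar u).left (R.bar v).left) :=
      ⟨le_max_right _ _, max_le h1 (R.bar v).left_lt_right.le⟩
    refine ⟨huv, (R.sees_iff k u v).2 ⟨_, hu, hv, ?_⟩⟩
    have hcard := R.cliqueFree_card_covers hR (max (R.bar u).left (R.bar v).left)
    set x := max (R.bar u).left (R.bar v).left
    have hsub : R.obstructions u v x ⊆
        (((Finset.univ.filter fun z => R.Covers z x).erase u : Finset V) : Set V) := by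
      intro w hw
      rw [mem_obstructions_iff] at hw
      simp [hw.1, hw.2.2.1]
    refine (encard_le_encard hsub).trans ?_
    rw [encard_coe_eq_coe_finsetCard, Finset.card_erase_of_mem (by simpa using hu)]
    exact_mod_cast by omega

end BarRepresentation

/-- If three mutually nonadjacent neighbours of `c` each have a neighbour not adjacent to `c`,
then the graph is not an interval graph. -/
theorem not_interval_of_spider {V : Type*} (G : SimpleGraph V) (l r : V → ℝ)
    (hlr : ∀ v, l v < r v) (hG : ∀ u v, G.Adj u v ↔ u ≠ v ∧ l u ≤ r v ∧ l v ≤ r u)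
    (c : V) (a b : Fin 3 → V) (hca : ∀ p, G.Adj c (a p)) (hab : ∀ p, G.Adj (a p) (b p))
    (hcb : ∀ p, c ≠ b p ∧ ¬ G.Adj c (b p))
    (haa : ∀ p q, p ≠ q → a p ≠ a q ∧ ¬ G.Adj (a p) (a q)) : False := by
  have order : ∀ p q, p ≠ q → r (a p) < l (a q) ∨ r (a q) < l (a p) := by
    intro p q hpq
    by_contra! hcon
    exact (haa p q hpq).2 ((hG _ _).2 ⟨(haa p q hpq).1, hcon.2, hcon.1⟩)
  -- The interval of `c` meets both outer intervals, so it contains the middle one and meets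
  -- everything the middle one meets.
  have key : ∀ p q s, r (a p) < l (a q) → r (a q) < l (a s) → False := by
    intro p q s h1 h2
    have e1 := ((hG _ _).1 (hca p)).2
    have e2 := ((hG _ _).1 (hca s)).2
    have e3 := ((hG _ _).1 (hab q)).2
    exact (hcb q).2 ((hG _ _).2 ⟨(hcb q).1, by linarith, by linarith⟩)
  have h0 := hlr (a 0)
  have h1 := hlr (a 1)
  have h2 := hlr (a 2)
  rcases order 0 1 (by decide) with h | h <;> rcases order 1 2 (by decide) with h' | h' <;>
    rcases order 0 2 (by decide) with h'' | h'' <;>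
    first
      | exact key _ _ _ h h'
      | exact key _ _ _ h' h
      | exact key _ _ _ h h''
      | exact key _ _ _ h'' h
      | exact key _ _ _ h' h''
      | exact key _ _ _ h'' h'

/-! ### Bars stacked at integer heights -/

theorem mem_family_of_subset {i j : ℕ} (h : barVisibilityFamily i ⊆ barVisibilityFamily j)
    {n : ℕ} (R : BarRepresentation (Fin n)) :
    ∃ R' : BarRepresentation (Fin n), R'.visibilityGraph j = R.visibilityGraph i :=
  @h ⟨n, R.visibilityGraph i⟩ ⟨R, rfl⟩

/-- A collection of bars, the height of the bar of `p` being `p`. -/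
def stackedBars (n : ℕ) (l r : Fin n → ℝ) (hlr : ∀ p, l p < r p) :
    BarRepresentation (Fin n) where
  bar p := ⟨l p, r p, (p : ℕ), hlr p⟩
  disjoint u v huv := by
    rw [Set.disjoint_left]
    rintro ⟨x, y⟩ h1 h2
    simp only [Bar.carrier, mem_prod, mem_singleton_iff] at h1 h2
    exact huv (Fin.ext (by exact_mod_cast h1.2.symm.trans h2.2))

theorem stackedBars_mem_obstructions {n : ℕ} {l r : Fin n → ℝ} (hlr : ∀ p, l p < r p)
    {u v : Fin n} (huv : u < v) (w : Fin n) (x : ℝ) :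
    w ∈ (stackedBars n l r hlr).obstructions u v x ↔ u < w ∧ w < v ∧ l w ≤ x ∧ x ≤ r w := by
  have hle : ((u : ℕ) : ℝ) ≤ ((v : ℕ) : ℝ) := by exact_mod_cast huv.le
  rw [BarRepresentation.mem_obstructions_iff]
  simp only [stackedBars, BarRepresentation.Covers, uIcc_of_le hle, mem_Icc, Nat.cast_le]
  constructor
  · rintro ⟨h1, h2, h3, h4, h5⟩
    exact ⟨lt_of_le_of_ne h4 (Ne.symm h1), lt_of_le_of_ne h5 h2, h3⟩
  · rintro ⟨h1, h2, h3⟩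
    exact ⟨h1.ne', h2.ne, h3, h1.le, h2.le⟩

theorem encard_le_of_forall_lt_le {n k a : ℕ} {s : Set (Fin n)}
    (hs : ∀ w ∈ s, a < (w : ℕ) ∧ (w : ℕ) ≤ a + k) : s.encard ≤ k := by
  rw [← Fin.val_injective.encard_image s]
  have hsub : Fin.val '' s ⊆ ((Finset.Ioc a (a + k) : Finset ℕ) : Set ℕ) := by
    rintro _ ⟨w, hw, rfl⟩
    simpa using hs w hw
  refine (encard_le_encard hsub).trans ?_
  rw [encard_coe_eq_coe_finsetCard]
  simp

/-- Heights are indices, so it suffices to confine the blocking indices to a window of `k`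
consecutive integers; `a` is the integer just below the window. -/
theorem stackedBars_adj_of {n k a : ℕ} {l r : Fin n → ℝ} (hlr : ∀ p, l p < r p)
    {u v : Fin n} (huv : u < v) (x : ℝ) (hu : l u ≤ x ∧ x ≤ r u) (hv : l v ≤ x ∧ x ≤ r v)
    (h : ∀ w, u < w → w < v → l w ≤ x → x ≤ r w → a < (w : ℕ) ∧ (w : ℕ) ≤ a + k) :
    ((stackedBars n l r hlr).visibilityGraph k).Adj u v := by
  refine ⟨huv.ne, (BarRepresentation.sees_iff ..).2 ⟨x, hu, hv, encard_le_of_forall_lt_le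
    (a := a) fun w hw => ?_⟩⟩
  rw [stackedBars_mem_obstructions hlr huv] at hw
  exact h w hw.1 hw.2.1 hw.2.2.1 hw.2.2.2

/-! ### The spider: a graph in `B_i` but in no `B_j` with `i < j` -/

section Spider

/-- The leg of the spider to which the vertex `p` belongs, for `i < p`. -/
def spiderLeg (i p : ℕ) : ℕ := (p - (i + 1)) % 3

/-- The abscissa of the left end of the bar of `p`. -/
def spiderLeft (i p : ℕ) : ℕ := if p ≤ i then 0 else 2 * spiderLeg i p

/-- The abscissa of the right end of the bar of `p`. -/
def spiderRight (i p : ℕ) : ℕ := if p ≤ i then 10 else 2 * spiderLeg i p + 1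

theorem spiderLeft_lt_spiderRight (i p : ℕ) : spiderLeft i p < spiderRight i p := by
  unfold spiderLeft spiderRight; split_ifs <;> omega

/-- A pile of `i + 1` long bars carrying three piles of two short bars. -/
def spider (i : ℕ) : BarRepresentation (Fin (i + 7)) :=
  stackedBars (i + 7) (fun p => spiderLeft i p) (fun p => spiderRight i p)
    fun p => by exact_mod_cast spiderLeft_lt_spiderRight i p

theorem spider_overlap {i : ℕ} {u v : Fin (i + 7)}
    (h : ((spider i).visibilityGraph i).Adj u v) :
    spiderLeft i u ≤ spiderRight i v ∧ spiderLeft i v ≤ spiderRight i u := by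
  obtain ⟨x, hu, hv, -⟩ := (BarRepresentation.sees_iff ..).1 h.2
  have h1 := hu.1.trans hv.2
  have h2 := hv.1.trans hu.2
  simp only [spider, stackedBars] at h1 h2
  exact ⟨by exact_mod_cast h1, by exact_mod_cast h2⟩

theorem spider_adj_of {i : ℕ} (a x : ℕ) {u v : Fin (i + 7)} (huv : u < v)
    (hu : spiderLeft i u ≤ x ∧ x ≤ spiderRight i u)
    (hv : spiderLeft i v ≤ x ∧ x ≤ spiderRight i v)
    (h : ∀ w : ℕ, (u : ℕ) < w → w < v → spiderLeft i w ≤ x → x ≤ spiderRight i w →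
      a < w ∧ w ≤ a + i) : ((spider i).visibilityGraph i).Adj u v := by
  refine stackedBars_adj_of (a := a) _ huv (x : ℝ) (by exact_mod_cast hu)
    (by exact_mod_cast hv) fun w h1 h2 h3 h4 => h w h1 h2 ?_ ?_
  · exact_mod_cast h3
  · exact_mod_cast h4

/-- Between the lowest bar and an upper short bar lie the other `i` long bars and the lower short
bar of the same leg: one obstruction too many. -/
theorem spider_not_adj_zero {i : ℕ} {u v : Fin (i + 7)} (hu : (u : ℕ) = 0)
    (hv : i + 4 ≤ (v : ℕ)) : ¬ ((spider i).visibilityGraph i).Adj u v := by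
  intro h
  obtain ⟨x, hxu, hxv, hx⟩ := (BarRepresentation.sees_iff ..).1 h.2
  have huv : u < v := by rw [Fin.lt_def]; omega
  simp only [BarRepresentation.Covers, spider, stackedBars] at hxu hxv
  let f : Fin (i + 1) → Fin (i + 7) := fun t =>
    if (t : ℕ) < i then ⟨t + 1, by omega⟩ else ⟨v - 3, by omega⟩
  have hf : Function.Injective f := by
    intro s t hst
    simp only [f] at hst
    split_ifs at hst <;> simp only [Fin.mk.injEq] at hst <;> ext <;> omega
  have hsub : range f ⊆ (spider i).obstructions u v x := by
    rintro _ ⟨t, rfl⟩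
    refine (stackedBars_mem_obstructions _ huv _ _).2 ?_
    by_cases ht : (t : ℕ) < i
    · simp only [f, ht, if_true, Fin.lt_def]
      have e1 : spiderLeft i (t + 1) = spiderLeft i u := by
        simp only [spiderLeft]; split_ifs <;> omega
      have e2 : spiderRight i (t + 1) = spiderRight i u := by
        simp only [spiderRight]; split_ifs <;> omega
      rw [e1, e2]
      exact ⟨by omega, by omega, hxu⟩
    · simp only [f, ht, if_false, Fin.lt_def]
      have e0 : spiderLeg i (v - 3) = spiderLeg i v := by
        simp only [spiderLeg]; omega
      have e1 : spiderLeft i (v - 3) = spiderLeft i v := by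
        simp only [spiderLeft, e0]; split_ifs <;> omega
      have e2 : spiderRight i (v - 3) = spiderRight i v := by
        simp only [spiderRight, e0]; split_ifs <;> omega
      rw [e1, e2]
      exact ⟨by omega, by omega, hxv⟩
  have hc := (encard_le_encard hsub).trans hx
  rw [← image_univ, hf.encard_image, encard_univ] at hc
  simp only [ENat.card_eq_coe_fintype_card, Fintype.card_fin] at hc
  have : i + 1 ≤ i := by exact_mod_cast hc
  omega

theorem spider_colorable (i : ℕ) : ((spider i).visibilityGraph i).Colorable (i + 2) := by
  -- The long bars get distinct colours and the lower short bars a new one. The upper short bars can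
  -- reuse the colour of bar `0`, which does not see them.
  let c : ℕ → ℕ := fun p => if p ≤ i then p else if p ≤ i + 3 then i + 1 else 0
  have hc : ∀ p, c p < i + 2 := by intro p; simp only [c]; split_ifs <;> omega
  let C : Fin (i + 7) → Fin (i + 2) := fun p => ⟨c p, hc p⟩
  have key : ∀ u v : Fin (i + 7), (u : ℕ) < v → ((spider i).visibilityGraph i).Adj u v →
      C u ≠ C v := by
    intro u v huv h heq
    have ho := spider_overlap h
    rw [Fin.ext_iff] at heq
    simp only [C, c] at heq
    by_cases hu : (u : ℕ) ≤ i
    · by_cases hv : (v : ℕ) ≤ i + 3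
      · split_ifs at heq <;> omega
      · refine spider_not_adj_zero ?_ (by omega) h
        split_ifs at heq <;> omega
    -- Two short bars of the same colour are on the same level, hence on different legs, and do not
    -- overlap.
    · simp only [spiderLeft, spiderRight, spiderLeg] at ho
      split_ifs at heq ho <;> omega
  refine ⟨SimpleGraph.Coloring.mk C fun {u v} h => ?_⟩
  rcases lt_trichotomy (u : ℕ) v with hlt | heq | hlt
  · exact key u v hlt h
  · exact absurd (Fin.ext heq) h.1
  · exact (key v u hlt h.symm).symm

theorem spider_not_isBarVisibilityGraph {i j : ℕ} (hij : i < j)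
    (R : BarRepresentation (Fin (i + 7)))
    (hR : R.visibilityGraph j = (spider i).visibilityGraph i) : False := by
  have hfree : (R.visibilityGraph j).CliqueFree (j + 2) := by
    rw [hR]
    exact (spider_colorable i).cliqueFree (by omega)
  have hadj := R.adj_iff_of_cliqueFree hfree
  rw [hR] at hadj
  -- The centre is the lowest long bar; the lower short bars are its neighbours, the upper ones the
  -- feet.
  refine not_interval_of_spider _ (fun v => (R.bar v).left) (fun v => (R.bar v).right)
    (fun v => (R.bar v).left_lt_right) hadj ⟨0, by omega⟩
    (fun p => ⟨i + 1 + p, by omega⟩) (fun p => ⟨i + 4 + p, by omega⟩) ?_ ?_ ?_ ?_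
  · intro p
    refine spider_adj_of 0 (2 * p) (by rw [Fin.lt_def]; dsimp only; omega) ?_ ?_ ?_
    all_goals simp only [spiderLeft, spiderRight, spiderLeg]
    · split_ifs <;> omega
    · split_ifs <;> omega
    · intro w; split_ifs <;> omega
  · intro p
    refine spider_adj_of (i + 1) (2 * p) (by rw [Fin.lt_def]; dsimp only; omega) ?_ ?_ ?_
    all_goals simp only [spiderLeft, spiderRight, spiderLeg]
    · split_ifs <;> omega
    · split_ifs <;> omega
    · intro w; split_ifs <;> omega
  · intro p
    refine ⟨by rw [ne_eq, Fin.ext_iff]; dsimp only; omega, spider_not_adj_zero rfl ?_⟩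
    dsimp only; omega
  · intro p q hpq
    rw [ne_eq, Fin.ext_iff] at hpq
    refine ⟨by rw [ne_eq, Fin.ext_iff]; dsimp only; omega, fun h => ?_⟩
    have ho := spider_overlap h
    simp only [spiderLeft, spiderRight, spiderLeg] at ho
    split_ifs at ho <;> omega

end Spider

/-! ### The upper bound on the number of edges -/

namespace BarRepresentation

/-- The bar of `w` ends before that of `z`, ties being broken by the order on the vertices. -/
def EndsBefore {V : Type*} [LinearOrder V] (R : BarRepresentation V) (w z : V) : Prop :=
  toLex ((R.bar w).right, w) < toLex ((R.bar z).right, z)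

theorem EndsBefore.right_le {V : Type*} [LinearOrder V] {R : BarRepresentation V} {w z : V} (h : R.EndsBefore w z) :
    (R.bar w).right ≤ (R.bar z).right := by
  rcases Prod.Lex.toLex_lt_toLex.1 h with h | h
  · exact h.le
  · exact h.1.le

section EdgeBound

variable {V : Type*} [Fintype V]

open Classical in
/-- The bars passing strictly between the bars of `u` and `v` over `x`. -/
noncomputable def between (R : BarRepresentation V) (u v : V) (x : ℝ) : Finset V :=
  Finset.univ.filter fun w => R.Covers w x ∧ (R.bar u).height < (R.bar w).height ∧
    (R.bar w).height < (R.bar v).height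

theorem mem_between {R : BarRepresentation V} {u v w : V} {x : ℝ} :
    w ∈ R.between u v x ↔ R.Covers w x ∧ (R.bar u).height < (R.bar w).height ∧
      (R.bar w).height < (R.bar v).height := by
  simp [between]

theorem encard_obstructions {R : BarRepresentation V} {u v : V} {x : ℝ} (hu : R.Covers u x)
    (hv : R.Covers v x) (h : (R.bar u).height < (R.bar v).height) :
    (R.obstructions u v x).encard = (R.between u v x).card := by
  rw [R.obstructions_eq_of_lt hu hv h, ← encard_coe_eq_coe_finsetCard]
  congr 1
  ext w
  simp [mem_between]

open Classical in
/-- The pairs seeing each other upwards from the left end of the lower bar `w`. -/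
noncomputable def leftUp (R : BarRepresentation V) (k : ℕ) (w : V) : Finset (V × V) :=
  (Finset.univ.filter fun v => R.Covers v (R.bar w).left ∧ (R.bar w).height < (R.bar v).height ∧
    (R.between w v (R.bar w).left).card ≤ k).image fun v => (w, v)

open Classical in
/-- The pairs seeing each other downwards from the left end of the upper bar `w`. -/
noncomputable def leftDown (R : BarRepresentation V) (k : ℕ) (w : V) : Finset (V × V) :=
  (Finset.univ.filter fun u => R.Covers u (R.bar w).left ∧ (R.bar u).height < (R.bar w).height ∧
    (R.between u w (R.bar w).left).card ≤ k).image fun u => (u, w)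

theorem between_eq_filter (R : BarRepresentation V) (u v : V) (x : ℝ)
    [DecidablePred fun z => R.Covers z x] :
    R.between u v x = (Finset.univ.filter fun z => R.Covers z x).filter fun z =>
      (R.bar u).height < (R.bar z).height ∧ (R.bar z).height < (R.bar v).height := by
  ext w; simp [mem_between]

/-- The partner is determined by the number of bars in between, one of `0, …, k`. -/
theorem card_leftUp_le (R : BarRepresentation V) (k : ℕ) (w : V) :
    (R.leftUp k w).card ≤ k + 1 := by
  classical
  refine Finset.card_image_le.trans ?_
  rw [← Finset.card_range (k + 1)]
  refine Finset.card_le_card_of_injOn (fun v => (R.between w v (R.bar w).left).card) ?_ ?_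
  · intro v hv
    have := (Finset.mem_filter.1 hv).2.2.2
    simp only [Finset.coe_range, mem_Iio]; omega
  · intro u hu v hv he
    have hu := (Finset.mem_filter.1 hu).2
    have hv := (Finset.mem_filter.1 hv).2
    simp only [between_eq_filter] at he
    exact eq_of_card_below_eq (h := fun z => (R.bar z).height)
      (fun a ha b hb h => R.eq_of_height_eq (by simpa using ha) (by simpa using hb) h)
      (by simpa using hu.1) (by simpa using hv.1) hu.2.1 hv.2.1 he

theorem card_leftDown_le (R : BarRepresentation V) (k : ℕ) (w : V) :
    (R.leftDown k w).card ≤ k + 1 := by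
  classical
  refine Finset.card_image_le.trans ?_
  rw [← Finset.card_range (k + 1)]
  refine Finset.card_le_card_of_injOn (fun u => (R.between u w (R.bar w).left).card) ?_ ?_
  · intro v hv
    have := (Finset.mem_filter.1 hv).2.2.2
    simp only [Finset.coe_range, mem_Iio]; omega
  · intro u hu v hv he
    have hu := (Finset.mem_filter.1 hu).2
    have hv := (Finset.mem_filter.1 hv).2
    simp only [between_eq_filter] at he
    exact eq_of_card_above_eq (h := fun z => (R.bar z).height)
      (fun a ha b hb h => R.eq_of_height_eq (by simpa using ha) (by simpa using hb) h)
      (by simpa using hu.1) (by simpa using hv.1) hu.2.1 hv.2.1 he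

variable [LinearOrder V]

open Classical in
/-- The bars alive just after the end of the bar of `w`. -/
noncomputable def alive (R : BarRepresentation V) (w : V) : Finset V :=
  Finset.univ.filter fun z => (R.bar z).left ≤ (R.bar w).right ∧ R.EndsBefore w z

theorem covers_of_mem_alive {R : BarRepresentation V} {w z : V} (h : z ∈ R.alive w) :
    R.Covers z (R.bar w).right := by
  simp only [alive, Finset.mem_filter] at h
  exact ⟨h.2.1, h.2.2.right_le⟩

theorem injOn_height_alive (R : BarRepresentation V) (w : V) :
    InjOn (fun z => (R.bar z).height) (R.alive w : Set V) :=
  fun _ hu _ hv h => R.eq_of_height_eq (covers_of_mem_alive hu) (covers_of_mem_alive hv) h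

open Classical in
/-- The pairs that begin to see each other when the bar of `w` ends. -/
noncomputable def rightEnd (R : BarRepresentation V) (k : ℕ) (w : V) : Finset (V × V) :=
  (R.alive w ×ˢ R.alive w).filter fun p => (R.bar p.1).height < (R.bar w).height ∧
    (R.bar w).height < (R.bar p.2).height ∧
    ((R.alive w).filter fun z => (R.bar p.1).height < (R.bar z).height ∧
      (R.bar z).height < (R.bar p.2).height).card = k

/-- The number of alive bars between `u` and `w` is at most `k` and determines `u`; the total of `k`
between `u` and `v` then determines `v`. -/
theorem card_rightEnd_le (R : BarRepresentation V) (k : ℕ) (w : V) :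
    (R.rightEnd k w).card ≤ k + 1 := by
  classical
  rw [← Finset.card_range (k + 1)]
  refine Finset.card_le_card_of_injOn (fun p => ((R.alive w).filter fun z =>
    (R.bar p.1).height < (R.bar z).height ∧ (R.bar z).height < (R.bar w).height).card) ?_ ?_
  · intro p hp
    have hp := (Finset.mem_filter.1 hp).2
    simp only [Finset.coe_range, mem_Iio]
    have := Finset.card_le_card (Finset.monotone_filter_right (R.alive w)
      (p := fun z => (R.bar p.1).height < (R.bar z).height ∧ (R.bar z).height < (R.bar w).height)
      (q := fun z => (R.bar p.1).height < (R.bar z).height ∧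
        (R.bar z).height < (R.bar p.2).height) fun z _ hz => ⟨hz.1, hz.2.trans hp.2.1⟩)
    omega
  · rintro ⟨u, v⟩ hp ⟨u', v'⟩ hq he
    obtain ⟨hp1, hp2, hp3, hp4⟩ := Finset.mem_filter.1 hp
    obtain ⟨hq1, hq2, hq3, hq4⟩ := Finset.mem_filter.1 hq
    rw [Finset.mem_product] at hp1 hq1
    dsimp only at *
    obtain rfl : u = u' := eq_of_card_above_eq (R.injOn_height_alive w) hp1.1 hq1.1 hp2 hq2 he
    obtain rfl : v = v' := eq_of_card_below_eq (R.injOn_height_alive w) hp1.2 hq1.2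
      (hp2.trans hp3) (hq2.trans hq3) (hp4.trans hq4.symm)
    rfl

-- Slide the line of sight to the left. Either it reaches the left end of `u` or `v`, or at some
-- right end of a bar in between it becomes blocked; the pair is charged to that end. The induction
-- is on the number of right ends left of `x`.
open Classical in
theorem mem_charged (R : BarRepresentation V) {k : ℕ} {u v : V}
    (huv : (R.bar u).height < (R.bar v).height) :
    ∀ N : ℕ, ∀ x : ℝ, (Finset.univ.filter fun w => (R.bar w).right < x).card ≤ N →
      R.Covers u x → R.Covers v x → (R.between u v x).card ≤ k →
      ∃ w, (u, v) ∈ R.leftUp k w ∪ R.leftDown k w ∪ R.rightEnd k w := by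
  intro N
  induction N using Nat.strong_induction_on with
  | _ N ih =>
  intro x hN hu hv hx
  have hul : (R.bar u).left ≤ max (R.bar u).left (R.bar v).left := le_max_left _ _
  have hvl : (R.bar v).left ≤ max (R.bar u).left (R.bar v).left := le_max_right _ _
  have hlx : max (R.bar u).left (R.bar v).left ≤ x := max_le hu.1 hv.1
  by_cases hl : (R.between u v (max (R.bar u).left (R.bar v).left)).card ≤ k
  · rcases le_total (R.bar u).left (R.bar v).left with h | h
    · rw [max_eq_right h] at hl hlx
      refine ⟨v, ?_⟩
      simp only [Finset.mem_union, leftDown, Finset.mem_image, Finset.mem_filter]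
      exact Or.inl (Or.inr ⟨u, ⟨Finset.mem_univ _, ⟨h, hlx.trans hu.2⟩, huv, hl⟩, rfl⟩)
    · rw [max_eq_left h] at hl hlx
      refine ⟨u, ?_⟩
      simp only [Finset.mem_union, leftUp, Finset.mem_image, Finset.mem_filter]
      exact Or.inl (Or.inl ⟨v, ⟨Finset.mem_univ _, ⟨h, hlx.trans hv.2⟩, huv, hl⟩, rfl⟩)
  set ℓ := max (R.bar u).left (R.bar v).left
  -- Bars between `u` and `v` that end while the line slides from `x` to `ℓ`. If there were none,
  -- every bar in between at `ℓ` would still be there at `x`.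
  let Q : Finset V := Finset.univ.filter fun w => (R.bar u).height < (R.bar w).height ∧
    (R.bar w).height < (R.bar v).height ∧ (R.bar w).right < x ∧ ℓ ≤ (R.bar w).right
  have hQ : Q.Nonempty := by
    by_contra hne
    refine hl ((Finset.card_le_card fun z hz => ?_).trans hx)
    rw [mem_between] at hz ⊢
    refine ⟨⟨hz.1.1.trans hlx, ?_⟩, hz.2⟩
    by_contra! hzx
    exact hne ⟨z, Finset.mem_filter.2 ⟨Finset.mem_univ _, hz.2.1, hz.2.2, hzx, hz.1.2⟩⟩
  obtain ⟨w₁, hw₁, hmax⟩ := Finset.exists_max_image Q (fun w => (R.bar w).right) hQ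
  obtain ⟨-, hw1, hw2, hw3, hw4⟩ := Finset.mem_filter.1 hw₁
  set e := (R.bar w₁).right
  have hue : R.Covers u e := ⟨hul.trans hw4, hw3.le.trans hu.2⟩
  have hve : R.Covers v e := ⟨hvl.trans hw4, hw3.le.trans hv.2⟩
  by_cases hek : (R.between u v e).card ≤ k
  · refine ih _ (lt_of_lt_of_le (Finset.card_lt_card ?_) hN) e le_rfl hue hve hek
    refine Finset.ssubset_iff_subset_ne.2 ⟨?_, fun heq => ?_⟩
    · exact Finset.monotone_filter_right _ fun z _ hz => lt_trans hz hw3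
    · have : w₁ ∈ Finset.univ.filter fun w => (R.bar w).right < e := by
        rw [heq]; simpa using hw3
      exact (Finset.mem_filter.1 this).2.false
  push Not at hek
  -- Several bars may end at `e`. Among the bars in between there, `t` consists of the `k + 1` last
  -- to end, and `w` is the first of these to end, so exactly `k` outlive it.
  obtain ⟨t, hts, htc, ht⟩ := Finset.exists_initial_subset_card_eq
    (fun z => OrderDual.toDual (toLex ((R.bar z).right, z))) (R.between u v e) (k + 1) hek
  obtain ⟨w, hwt, hwmin⟩ := Finset.exists_min_image t (fun z => toLex ((R.bar z).right, z))
    (Finset.card_pos.1 (by omega))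
  have hwb := mem_between.1 (hts hwt)
  -- Otherwise all of `t` ends after `e`, hence not before `x` by the choice of `e`, and `k + 1`
  -- bars block the sight at `x`.
  have hwe : (R.bar w).right = e := by
    refine le_antisymm ?_ hwb.1.2
    by_contra! hlt
    have hsub : t ⊆ R.between u v x := by
      intro z hz
      have hzb := mem_between.1 (hts hz)
      refine mem_between.2 ⟨⟨hzb.1.1.trans hw3.le, ?_⟩, hzb.2⟩
      by_contra! hzx
      have h1 : (R.bar z).right ≤ e := hmax z (Finset.mem_filter.2
        ⟨Finset.mem_univ _, hzb.2.1, hzb.2.2, hzx, hw4.trans hzb.1.2⟩)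
      have h2 : (R.bar w).right ≤ (R.bar z).right := by
        rcases Prod.Lex.toLex_le_toLex.1 (hwmin z hz) with h | h
        · exact h.le
        · exact h.1.le
      exact absurd (h2.trans h1) hlt.not_ge
    have := Finset.card_le_card hsub
    omega
  refine ⟨w, Finset.mem_union_right _ ?_⟩
  have hAlive : ∀ z, z ∈ R.alive w ↔ (R.bar z).left ≤ e ∧ R.EndsBefore w z := by
    intro z; simp [alive, hwe]
  have hends : ∀ z, x ≤ (R.bar z).right → R.EndsBefore w z := fun z hz =>
    Prod.Lex.toLex_lt_toLex.2 (Or.inl (show (R.bar w).right < _ by rw [hwe]; exact hw3.trans_le hz))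
  simp only [rightEnd, Finset.mem_filter, Finset.mem_product, hAlive]
  refine ⟨⟨⟨hue.1, hends u hu.2⟩, hve.1, hends v hv.2⟩, hwb.2.1, hwb.2.2, ?_⟩
  have : ((R.alive w).filter fun z => (R.bar u).height < (R.bar z).height ∧
      (R.bar z).height < (R.bar v).height) = t.erase w := by
    ext z
    rw [Finset.mem_filter, hAlive, Finset.mem_erase]
    constructor
    · rintro ⟨⟨h1, h2⟩, h3⟩
      refine ⟨by rintro rfl; exact lt_irrefl _ h2, ht w hwt z (mem_between.2 ⟨⟨h1, ?_⟩, h3⟩) ?_⟩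
      · exact hwe ▸ h2.right_le
      · exact OrderDual.toDual_lt_toDual.2 h2
    · rintro ⟨h1, h2⟩
      have hzb := mem_between.1 (hts h2)
      refine ⟨⟨hzb.1.1, lt_of_le_of_ne (hwmin z h2) fun h => h1 ?_⟩, hzb.2⟩
      exact (congrArg (fun p => (ofLex p).2) h).symm
  rw [this, Finset.card_erase_of_mem hwt, htc, Nat.add_sub_cancel]

-- Each edge is charged to an end of some bar, and each bar receives at most `k + 1` charges of each
-- of three kinds.
open Classical in
theorem card_edgeFinset_le (R : BarRepresentation V) (k : ℕ) :
    (R.visibilityGraph k).edgeFinset.card ≤ 3 * (k + 1) * Fintype.card V := by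
  have hsub : (R.visibilityGraph k).edgeFinset ⊆
      (Finset.univ.biUnion fun w => R.leftUp k w ∪ R.leftDown k w ∪ R.rightEnd k w).image
        fun p => s(p.1, p.2) := by
    have key : ∀ u v, R.Sees k u v → (R.bar u).height < (R.bar v).height →
        s(u, v) ∈ (Finset.univ.biUnion fun w =>
          R.leftUp k w ∪ R.leftDown k w ∪ R.rightEnd k w).image fun p => s(p.1, p.2) := by
      intro u v hs huv
      obtain ⟨x, hu, hv, hx⟩ := (R.sees_iff k u v).1 hs
      rw [encard_obstructions hu hv huv] at hx
      obtain ⟨w, hw⟩ := R.mem_charged huv _ x le_rfl hu hv (by exact_mod_cast hx)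
      exact Finset.mem_image.2 ⟨(u, v), Finset.mem_biUnion.2 ⟨w, Finset.mem_univ _, hw⟩, rfl⟩
    intro e he
    induction e using Sym2.ind with
    | _ u v =>
    rw [SimpleGraph.mem_edgeFinset, SimpleGraph.mem_edgeSet] at he
    obtain ⟨x, hu, hv, -⟩ := (R.sees_iff k u v).1 he.2
    rcases lt_trichotomy (R.bar u).height (R.bar v).height with h | h | h
    · exact key u v he.2 h
    · exact absurd (R.eq_of_height_eq hu hv h) he.1
    · rw [Sym2.eq_swap]; exact key v u he.2.symm h
  refine (Finset.card_le_card hsub).trans (Finset.card_image_le.trans ?_)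
  rw [mul_comm, ← smul_eq_mul, ← Finset.card_univ]
  refine Finset.card_biUnion_le_card_mul _ _ _ fun w _ => ?_
  have h1 := R.card_leftUp_le k w
  have h2 := R.card_leftDown_le k w
  have h3 := R.card_rightEnd_le k w
  have h4 := Finset.card_union_le (R.leftUp k w ∪ R.leftDown k w) (R.rightEnd k w)
  have h5 := Finset.card_union_le (R.leftUp k w) (R.leftDown k w)
  omega

end EdgeBound

end BarRepresentation

/-! ### The staircase: nearly as many edges as the bound allows -/

section Staircase

/-- The abscissa of the left end of the bar of `p`. -/
def staircaseLeft (k N p : ℕ) : ℕ := if k < p ∧ p ≤ N + k then p else 0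

/-- The abscissa of the right end of the bar of `p`. -/
def staircaseRight (k N p : ℕ) : ℕ := if k < p ∧ p ≤ N + k then p + k + 1 else N + 2 * k + 2

theorem staircaseLeft_lt_staircaseRight (k N p : ℕ) :
    staircaseLeft k N p < staircaseRight k N p := by
  unfold staircaseLeft staircaseRight; split_ifs <;> omega

/-- A staircase of `N` bars between two piles of `k + 1` long bars. -/
def staircase (k N : ℕ) : BarRepresentation (Fin (N + 2 * (k + 1))) :=
  stackedBars _ (fun p => staircaseLeft k N p) (fun p => staircaseRight k N p)
    fun p => by exact_mod_cast staircaseLeft_lt_staircaseRight k N p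

theorem staircase_adj_of {k N : ℕ} (a x : ℕ) {u v : Fin (N + 2 * (k + 1))} (huv : u < v)
    (hu : staircaseLeft k N u ≤ x ∧ x ≤ staircaseRight k N u)
    (hv : staircaseLeft k N v ≤ x ∧ x ≤ staircaseRight k N v)
    (h : ∀ w : ℕ, (u : ℕ) < w → w < v → staircaseLeft k N w ≤ x → x ≤ staircaseRight k N w →
      a < w ∧ w ≤ a + k) : ((staircase k N).visibilityGraph k).Adj u v := by
  refine stackedBars_adj_of (a := a) _ huv (x : ℝ) (by exact_mod_cast hu)
    (by exact_mod_cast hv) fun w h1 h2 h3 h4 => h w h1 h2 ?_ ?_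
  · exact_mod_cast h3
  · exact_mod_cast h4

-- Each of the first `M` steps sees the `k + 1` long bars below, the next `k + 1` steps, and the `k
-- + 1` long bars above. The `k + 1` additional steps ensure that the next steps exist.
open Classical in
theorem staircase_card_edgeFinset (k M : ℕ) :
    3 * (k + 1) * M ≤
      ((staircase k (M + (k + 1))).visibilityGraph k).edgeFinset.card := by
  let f : Fin M × Fin 3 × Fin (k + 1) →
      Fin (M + (k + 1) + 2 * (k + 1)) × Fin (M + (k + 1) + 2 * (k + 1)) := fun q =>
    if q.2.1 = 0 then (⟨q.2.2, by omega⟩, ⟨k + 1 + q.1, by omega⟩)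
    else if q.2.1 = 1 then (⟨k + 1 + q.1, by omega⟩, ⟨k + 1 + q.1 + (q.2.2 + 1), by omega⟩)
    else (⟨k + 1 + q.1, by omega⟩, ⟨M + 2 * (k + 1) + q.2.2, by omega⟩)
  have hlt : ∀ q, (f q).1 < (f q).2 := by
    intro q
    simp only [f]
    split_ifs <;> simp only [Fin.mk_lt_mk] <;> omega
  have hinj : Function.Injective f := by
    rintro ⟨t, c, d⟩ ⟨t', c', d'⟩ h
    have ht := t.2
    have ht' := t'.2
    have hd := d.2
    have hd' := d'.2
    simp only [f] at h
    simp only [Prod.mk.injEq]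
    fin_cases c <;> fin_cases c' <;> simp [Fin.ext_iff] at h ⊢ <;> omega
  have hadj : ∀ q, ((staircase k (M + (k + 1))).visibilityGraph k).Adj (f q).1 (f q).2 := by
    rintro ⟨t, c, d⟩
    have ht := t.2
    have hd := d.2
    fin_cases c <;> simp [f]
    -- At the right end of a step all lower steps have ended, so only long bars can block.
    · refine staircase_adj_of d (t + k + 1 + k + 1)
        (by simp only [Fin.lt_def]; omega) ?_ ?_ ?_ <;>
        simp only [staircaseLeft, staircaseRight]
      · split_ifs <;> omega
      · split_ifs <;> omega
      · intro w; split_ifs <;> omega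
    -- At the left end of the higher step, only the `d` steps in between can block.
    · refine staircase_adj_of (k + 1 + t) (k + 1 + t + (d + 1))
        (by simp only [Fin.lt_def]; omega) ?_ ?_ ?_ <;>
        simp only [staircaseLeft, staircaseRight]
      · split_ifs <;> omega
      · split_ifs <;> omega
      · intro w; split_ifs <;> omega
    -- At the left end of a step no higher step has begun, so only long bars can block.
    · refine staircase_adj_of (M + 2 * k + 1) (t + k + 1)
        (by simp only [Fin.lt_def]; omega) ?_ ?_ ?_ <;>
        simp only [staircaseLeft, staircaseRight]
      · split_ifs <;> omega
      · split_ifs <;> omega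
      · intro w; split_ifs <;> omega
  have hcard : (Finset.univ : Finset (Fin M × Fin 3 × Fin (k + 1))).card = 3 * (k + 1) * M := by
    simp only [Finset.card_univ, Fintype.card_prod, Fintype.card_fin]; ring
  rw [← hcard]
  refine Finset.card_le_card_of_injOn (fun q => s((f q).1, (f q).2)) ?_ ?_
  · intro q _
    simpa using hadj q
  · intro q _ q' _ h
    refine hinj ?_
    rcases Sym2.eq_iff.1 h with h | h
    · exact Prod.ext h.1 h.2
    · have h1 := hlt q
      rw [h.1, h.2] at h1
      exact absurd h1 (hlt q').not_gt

end Staircase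

/-! ### The two non-inclusions -/

theorem not_subset_of_lt {i j : ℕ} (hij : i < j) :
    ¬ barVisibilityFamily i ⊆ barVisibilityFamily j := by
  intro h
  obtain ⟨R, hR⟩ := mem_family_of_subset h (spider i)
  exact spider_not_isBarVisibilityGraph hij R hR

theorem not_subset_of_gt {i j : ℕ} (hij : j < i) :
    ¬ barVisibilityFamily i ⊆ barVisibilityFamily j := by
  classical
  intro h
  -- With `M` counted steps there are `M + 3 * (i + 1)` vertices. As `j + 1 ≤ i`, the two bounds
  -- give `3 * (i + 1) * M ≤ 3 * i * (M + 3 * (i + 1))`, that is `M ≤ 3 * i * (i + 1)`; the chosen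
  -- `M` is one more.
  obtain ⟨R, hR⟩ := mem_family_of_subset h (staircase i (3 * i * (i + 1) + 1 + (i + 1)))
  have h1 := staircase_card_edgeFinset i (3 * i * (i + 1) + 1)
  have h2 := R.card_edgeFinset_le j
  generalize R.visibilityGraph j = G at hR h2
  subst hR
  rw [Fintype.card_fin] at h2
  have h3 : 3 * (j + 1) * (3 * i * (i + 1) + 1 + (i + 1) + 2 * (i + 1)) ≤
      3 * i * (3 * i * (i + 1) + 1 + (i + 1) + 2 * (i + 1)) :=
    Nat.mul_le_mul_right _ (by omega)
  have h4 := (h1.trans h2).trans h3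
  ring_nf at h4
  omega

theorem mainTheorem7 (i j : ℕ) (hij : i ≠ j) :
    ¬ barVisibilityFamily i ⊆ barVisibilityFamily j ∧
      ¬ barVisibilityFamily j ⊆ barVisibilityFamily i := by
  rcases hij.lt_or_gt with h | h
  · exact ⟨not_subset_of_lt h, not_subset_of_gt h⟩
  · exact ⟨not_subset_of_gt h, not_subset_of_lt h⟩
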